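/- Let $\mathbb{K}$ be an algebraically closed field with a nontrivial valuation $\mathrm{val}:\mathbb{K}^*\to\mathbb{R}$ of rank one whose residue field $K$ has characteristic zero, and let $n\ge 4$. Let $Sev_n^2\subset\mathbb{K}^{n+1}$ be the Zariski closure of the set of coefficient vectors $(c_0,\dots,c_n)$ of the polynomials $$\sum_{i=0}^n c_i x^i=\ell\,(x-a)^2(x-b)^2\prod_{i=1}^{n-4}(x-r_i),$$ where $\ell,a,b,r_1,\dots,r_{n-4}\in\mathbb{K}^*$ and $a,b,r_1,\dots,r_{n-4}$ are pairwise different. Its tropicalization $\mathcal{T}(Sev_n^2)\subset\mathbb{R}^{n+1}$ is the set of all $w$ such that, for every nonzero Laurent polynomial $g=\sum_\alpha g_\alpha x^\alpha$ vanishing on $Sev_n^2\cap(\mathbb{K}^*)^{n+1}$, the minimum $\min\{\mathrm{val}(g_\alpha)+\langle w,\alpha\rangle : g_\alpha\neq 0\}$ is attained at least twice. For $w\in\mathbb{R}^{n+1}$ let $\Pi_w$ be the regular subdivision of $\{0,\dots,n\}$ induced by $w$: its cells are the sets $\{j : (j,w_j)\in F\}$, where $F$ runs over the lower edges of the convex hull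 of $\{(0,w_0),\dots,(n,w_n)\}$. A point of a cell is marked if it is neither the least nor the greatest element of the cell, and a cell is marked if it has a marked point. Let $\Pi$ be a regular subdivision with exactly one marked cell $J=\{i_1<i_2<i_3<i_4\}$, which has four elements (so two marked points) and is not a translate of one of the sets $\{0,1,2,3\}$, $\{0,1,2,4\}$, $\{0,2,3,4\}$, $\{0,3,4,6\}$, $\{0,2,3,6\}$. The closure $C_\Pi$ of $\{w\in\mathbb{R}^{n+1} : \Pi_w=\Pi\}$ is called a cone of type II with marked cell $J$. Let $$D_J(x)=\det\begin{pmatrix}1&1&1&1\\ i_1&i_2&i_3&i_4\\ x^{i_1}&x^{i_2}&x^{i_3}&x^{i_4}\\ i_1x^{i_1}&i_2x^{i_2}&i_3x^{i_3}&i_4x^{i_4}\end{pmatrix}\in\mathbb{Z}[x].$$ **Theorem.** Let $w\in\mathbb{R}^{n+1}$ be a point of a cone of type II with marked cell $J=\{i_1<i_2<i_3<i_4\}$. If $D_J$ has a root $\beta\in K\setminus\{0,1\}$ such that every value occurs at most twice among $\beta^{i_1},\beta^{i_2},\beta^{i_3},\beta^{i_4}$, then $w\in\mathcal{T}(Sev_n^2)$.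 -/

import Mathlib

namespace TropSev

/-! ### Valued fields -/

section Valued

variable {𝕂 : Type*} [Field 𝕂]

/-- The residue field of a rank one (real valued, written additively) valuation. -/
abbrev ResField (v : AddValuation 𝕂 (WithTop ℝ)) : Type _ :=
  IsLocalRing.ResidueField (AddValuation.toValuation v).valuationSubring

end Valued

/-! ### Tropicalization -/

section Tropicalization

variable {𝕂 : Type*} [Field 𝕂] {N : ℕ}

/-- Laurent polynomials in `x_0, …, x_{N-1}`: the exponent of a monomial is a vector of integers. -/
abbrev LaurentPoly (𝕂 : Type*) [Field 𝕂] (N : ℕ) : Type _ :=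
  AddMonoidAlgebra 𝕂 (Fin N → ℤ)

/-- The value `c^α = ∏ i, c_i ^ α_i` of the Laurent monomials at the point `c` of the torus. -/
def monomialEval (c : Fin N → 𝕂ˣ) : Multiplicative (Fin N → ℤ) →* 𝕂 where
  toFun α := ((∏ i, c i ^ (α.toAdd i) : 𝕂ˣ) : 𝕂)
  map_one' := by simp
  map_mul' α γ := by simp [zpow_add, Finset.prod_mul_distrib]

/-- Evaluation of Laurent polynomials at a point of the torus. -/
noncomputable def laurentEval (c : Fin N → 𝕂ˣ) : LaurentPoly 𝕂 N →ₐ[𝕂] 𝕂 :=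
  AddMonoidAlgebra.lift 𝕂 𝕂 (Fin N → ℤ) (monomialEval c)

/-- The ideal, in the Laurent polynomial ring, of the intersection of `X` with the torus. -/
noncomputable def torusIdeal (X : Set (Fin N → 𝕂)) : Ideal (LaurentPoly 𝕂 N) :=
  ⨅ c ∈ {c : Fin N → 𝕂ˣ | (fun i => (c i : 𝕂)) ∈ X}, RingHom.ker (laurentEval c)

/-- The term `val(g_α) + ⟨w, α⟩` of the tropical polynomial `trop(g)` at `w`. -/
noncomputable def tropTerm (v : AddValuation 𝕂 (WithTop ℝ)) (g : LaurentPoly 𝕂 N)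
    (w : Fin N → ℝ) (α : Fin N → ℤ) : WithTop ℝ :=
  v (g.coeff α) + ((∑ i, w i * (α i : ℝ) : ℝ) : WithTop ℝ)

/-- The zero set `V(trop(g))`: the minimum of the terms of `trop(g)` at `w` is attained at least
twice. -/
def tropHypersurface (v : AddValuation 𝕂 (WithTop ℝ)) (g : LaurentPoly 𝕂 N) :
    Set (Fin N → ℝ) :=
  {w | ∃ α ∈ g.coeff.support, ∃ γ ∈ g.coeff.support, α ≠ γ ∧
    tropTerm v g w α = tropTerm v g w γ ∧
    ∀ δ ∈ g.coeff.support, tropTerm v g w α ≤ tropTerm v g w δ}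

/-- The tropicalization of an ideal of the Laurent polynomial ring. -/
def tropIdeal (v : AddValuation 𝕂 (WithTop ℝ)) (I : Ideal (LaurentPoly 𝕂 N)) :
    Set (Fin N → ℝ) :=
  {w | ∀ g ∈ I, g ≠ 0 → w ∈ tropHypersurface v g}

/-- The tropicalization of an affine variety: the one of its intersection with the torus. -/
noncomputable def tropVariety (v : AddValuation 𝕂 (WithTop ℝ)) (X : Set (Fin N → 𝕂)) :
    Set (Fin N → ℝ) :=
  tropIdeal v (torusIdeal X)

/-- Zariski closure of a subset of affine space. -/
def zariskiClosure (S : Set (Fin N → 𝕂)) : Set (Fin N → 𝕂) :=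
  MvPolynomial.zeroLocus 𝕂 (MvPolynomial.vanishingIdeal 𝕂 S)

end Tropicalization

/-! ### The Severi variety -/

section Severi

variable (𝕂 : Type*) [Field 𝕂]

open Polynomial in
/-- The polynomial `ℓ (x - a)² (x - b)² ∏ (x - r_i)`, of degree `n` when `4 ≤ n` and `ℓ ≠ 0`. -/
noncomputable def twoNodePoly {𝕂 : Type*} [Field 𝕂] {n : ℕ} (ℓ a b : 𝕂) (r : Fin (n - 4) → 𝕂) :
    Polynomial 𝕂 :=
  C ℓ * (X - C a) ^ 2 * (X - C b) ^ 2 * ∏ i, (X - C (r i))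

/-- Coefficient vectors of the polynomials of degree `n` with two double roots `a`, `b`
and simple roots `r_i`, all of them different and nonzero (for `4 ≤ n`). -/
def twoNodeSet (n : ℕ) : Set (Fin (n + 1) → 𝕂) :=
  {c | ∃ (ℓ a b : 𝕂) (r : Fin (n - 4) → 𝕂),
    ℓ ≠ 0 ∧ a ≠ 0 ∧ b ≠ 0 ∧ (∀ i, r i ≠ 0) ∧
    a ≠ b ∧ (∀ i, r i ≠ a) ∧ (∀ i, r i ≠ b) ∧ Function.Injective r ∧
    ∀ i : Fin (n + 1), c i = (twoNodePoly (n := n) ℓ a b r).coeff i}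

/-- The Severi variety `Sev_n^2` (for `4 ≤ n`). -/
def Sev (n : ℕ) : Set (Fin (n + 1) → 𝕂) :=
  zariskiClosure (twoNodeSet 𝕂 n)

variable {𝕂} in
/-- The tropical Severi variety. -/
noncomputable def tropSev (v : AddValuation 𝕂 (WithTop ℝ)) (n : ℕ) : Set (Fin (n + 1) → ℝ) :=
  tropVariety v (Sev 𝕂 n)

end Severi

/-! ### The matrix and its minors -/

section Minors

open Polynomial

/-- The matrix with columns `(1, j, x^j, j x^j)`, for `j = 0, …, n`. -/
noncomputable def bigM (n : ℕ) : Matrix (Fin 4) (Fin (n + 1)) (Polynomial ℤ) :=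
  Matrix.of fun k j =>
    ![1, ((j : ℕ) : Polynomial ℤ), X ^ (j : ℕ), ((j : ℕ) : Polynomial ℤ) * X ^ (j : ℕ)] k

/-- The `4 × 4` minor `D_J` on the columns `i_1 < i_2 < i_3 < i_4`. -/
noncomputable def minorD {n : ℕ} (i : Fin 4 → Fin (n + 1)) : Polynomial ℤ :=
  ((bigM n).submatrix id i).det

end Minors

/-! ### Regular subdivisions of `{0, …, n}` and cones of type II -/

section Subdivisions

variable {n : ℕ}

/-- The first coordinates of the points of `{(0, w_0), …, (n, w_n)}` which lie in the lower face of
their convex hull with inner normal `(η, 1)`. -/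
noncomputable def lowerCell (w : Fin (n + 1) → ℝ) (η : ℝ) : Finset (Fin (n + 1)) :=
  open Classical in
  Finset.univ.filter fun j =>
    ∀ k : Fin (n + 1), η * ((j : ℕ) : ℝ) + w j ≤ η * ((k : ℕ) : ℝ) + w k

/-- The regular subdivision `Π_w` of `{0, …, n}`: its cells come from the lower faces of the
Newton diagram which are segments. -/
def subdivision (w : Fin (n + 1) → ℝ) : Set (Finset (Fin (n + 1))) :=
  {σ | 2 ≤ σ.card ∧ ∃ η : ℝ, σ = lowerCell w η}

/-- The marked points of a cell: those in the relative interior of the segment it spans. -/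
def markedPoints (σ : Finset (Fin (n + 1))) : Finset (Fin (n + 1)) :=
  σ.filter fun j => (∃ k ∈ σ, k < j) ∧ ∃ l ∈ σ, j < l

/-- A cell is marked if it has a marked point. -/
def IsMarkedCell (σ : Finset (Fin (n + 1))) : Prop :=
  (markedPoints σ).Nonempty

/-- The closure `C_Π` of the set of weights which induce the subdivision `Π`. -/
def cone (Pi : Set (Finset (Fin (n + 1)))) : Set (Fin (n + 1) → ℝ) :=
  closure {w | subdivision w = Pi}

/-- The exceptional configurations. -/
def exceptional : Set (Finset ℤ) :=
  {{0, 1, 2, 3}, {0, 1, 2, 4}, {0, 2, 3, 4}, {0, 3, 4, 6}, {0, 2, 3, 6}}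

/-- `J` is the image under a translation of an exceptional configuration. -/
def IsTranslateOfExceptional (J : Finset (Fin (n + 1))) : Prop :=
  ∃ E ∈ exceptional, ∃ s : ℤ,
    J.image (fun j : Fin (n + 1) => ((j : ℕ) : ℤ)) = E.image fun e => e + s

/-- `Pi` is a regular subdivision whose only marked cell is the four element set `J`, which has two
marked points and is not the image under a translation of an exceptional configuration. -/
structure IsTypeII (Pi : Set (Finset (Fin (n + 1)))) (J : Finset (Fin (n + 1))) : Prop where
  regular : ∃ w : Fin (n + 1) → ℝ, subdivision w = Pi
  mem : J ∈ Pi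
  card : J.card = 4
  two_marked : (markedPoints J).card = 2
  unique_marked : ∀ σ ∈ Pi, IsMarkedCell σ → σ = J
  not_exceptional : ¬ IsTranslateOfExceptional J

/-- `C` is a cone of type II with marked cell `J`. -/
def IsTypeIICone (C : Set (Fin (n + 1) → ℝ)) (J : Finset (Fin (n + 1))) : Prop :=
  ∃ Pi : Set (Finset (Fin (n + 1))), IsTypeII Pi J ∧ C = cone Pi

end Subdivisions

end TropSev

namespace TropSev

/-! ### Tropicalization -/

section Tropical

variable {𝕂 : Type*} [Field 𝕂] {N : ℕ} (v : AddValuation 𝕂 (WithTop ℝ))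

/-! Tropical hypersurfaces are closed, so it suffices to treat weights that induce the subdivision
itself, and among those the approximating ones with entries in the value group, which is dense in
`ℝ`. Subtracting an affine function of the index makes the weight zero on `J` and positive off `J`.
It remains to find a polynomial over the valuation ring with units as coefficients on `J`,
coefficients of prescribed positive valuation off `J`, and two different nonzero double roots,
normalised to `1` and `b`.

Double roots at `1` and `b` are four linear conditions. Fix the coefficients off `J` up to a common
factor and take the four on `J` as unknowns, the common factor being tied to the last of them. This
gives a square system whose determinant, as a polynomial in `b`, reduces to `D_J` over the residue
field. The root `β` lifts to a root `b` (`exists_root_of_residue_root`), and a column of the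
adjugate solves the system. Its entries are units: over the residue field a kernel vector with a
zero entry would be a trinomial with double roots `1` and `β`, which forces three equal powers of
`β` (`trinomial_double_roots`). All this is `exists_double_root_lift`. The other roots of the
polynomial may coincide, which costs nothing in a Zariski closure (`coeff_twoNodePoly_mem_Sev`). -/

lemma exists_valuation_eq_coe {x : 𝕂} (hx : x ≠ 0) : ∃ r : ℝ, v x = r :=
  ⟨(v x).untop ((AddValuation.ne_top_iff v).2 hx), (WithTop.coe_untop _ _).symm⟩

lemma isClosed_tropHypersurface (g : LaurentPoly 𝕂 N) : IsClosed (tropHypersurface v g) := by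
  have hval : ∀ α : Fin N → ℤ, ∃ r : ℝ, α ∈ g.coeff.support → v (g.coeff α) = r := by
    intro α
    by_cases h : α ∈ g.coeff.support
    · obtain ⟨r, hr⟩ := exists_valuation_eq_coe v (Finsupp.mem_support_iff.1 h)
      exact ⟨r, fun _ => hr⟩
    · exact ⟨0, fun h' => absurd h' h⟩
  choose r hr using hval
  let F : (Fin N → ℤ) → (Fin N → ℝ) → ℝ := fun α w => r α + ∑ i, w i * (α i : ℝ)
  have hF : ∀ α, Continuous (F α) := fun α => by fun_prop
  have hterm : ∀ α ∈ g.coeff.support, ∀ w, tropTerm v g w α = (F α w : WithTop ℝ) := by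
    intro α hα w
    simp only [tropTerm, hr α hα, F, WithTop.coe_add]
  have hset : tropHypersurface v g = ⋃ α ∈ g.coeff.support, ⋃ γ ∈ g.coeff.support,
      {w | α ≠ γ ∧ F α w = F γ w ∧ ∀ δ ∈ g.coeff.support, F α w ≤ F δ w} := by
    ext w
    simp only [tropHypersurface, Set.mem_ofPred_eq, Set.mem_iUnion, exists_prop]
    refine exists_congr fun α => and_congr_right fun hα => exists_congr fun γ =>
      and_congr_right fun hγ => and_congr_right fun _ => and_congr ?_ ?_
    · rw [hterm α hα, hterm γ hγ, WithTop.coe_eq_coe]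
    · refine forall₂_congr fun δ hδ => ?_
      rw [hterm α hα, hterm δ hδ, WithTop.coe_le_coe]
  rw [hset]
  refine isClosed_biUnion_finset fun α _ => isClosed_biUnion_finset fun γ _ => ?_
  refine isClosed_const.and ((isClosed_eq (hF α) (hF γ)).and ?_)
  simp only [Set.ofPred_forall]
  exact isClosed_biInter fun δ _ => isClosed_le (hF α) (hF δ)

/-- Used twice: to pass to the closure defining the cone, and to replace a weight by nearby ones
with entries in the value group. -/
lemma isClosed_tropIdeal (I : Ideal (LaurentPoly 𝕂 N)) : IsClosed (tropIdeal v I) := by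
  simp only [tropIdeal, Set.ofPred_forall]
  exact isClosed_iInter fun g => isClosed_iInter fun _ => isClosed_iInter fun _ =>
    isClosed_tropHypersurface v g

lemma valuation_prod {ι : Type*} (s : Finset ι) (f : ι → 𝕂) :
    v (∏ i ∈ s, f i) = ∑ i ∈ s, v (f i) := by
  classical
  induction s using Finset.induction_on with
  | empty => simp [AddValuation.map_one]
  | insert a s ha ih => rw [Finset.prod_insert ha, Finset.sum_insert ha, AddValuation.map_mul, ih]

lemma valuation_inv_of_eq {x : 𝕂} {r : ℝ} (hr : v x = r) : v x⁻¹ = ((-r : ℝ) : WithTop ℝ) := by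
  have hx : x ≠ 0 := by
    rw [← AddValuation.ne_top_iff v, hr]
    exact WithTop.coe_ne_top
  obtain ⟨s, hs⟩ := exists_valuation_eq_coe v (inv_ne_zero hx)
  have h := AddValuation.map_mul v x x⁻¹
  rw [mul_inv_cancel₀ hx, AddValuation.map_one, hr, hs, ← WithTop.coe_add, ← WithTop.coe_zero,
    WithTop.coe_eq_coe] at h
  rw [hs, WithTop.coe_eq_coe]
  linarith

lemma valuation_pow_of_eq {x : 𝕂} {r : ℝ} (hr : v x = r) (k : ℕ) :
    v (x ^ k) = ((k * r : ℝ) : WithTop ℝ) := by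
  rw [AddValuation.map_pow, hr, ← WithTop.coe_nsmul, nsmul_eq_mul]

lemma valuation_zpow_of_eq {x : 𝕂} {r : ℝ} (hr : v x = r) (k : ℤ) :
    v (x ^ k) = ((k * r : ℝ) : WithTop ℝ) := by
  cases k with
  | ofNat k => simpa using valuation_pow_of_eq v hr k
  | negSucc k =>
    rw [zpow_negSucc, valuation_inv_of_eq v (valuation_pow_of_eq v hr (k + 1)), WithTop.coe_eq_coe]
    push_cast
    ring

lemma valuation_term {c : Fin N → 𝕂ˣ} {w : Fin N → ℝ} (hc : ∀ i, v (c i : 𝕂) = w i)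
    (g : LaurentPoly 𝕂 N) (α : Fin N → ℤ) :
    v (g.coeff α * monomialEval c (Multiplicative.ofAdd α)) = tropTerm v g w α := by
  rw [AddValuation.map_mul, tropTerm]
  congr 1
  simp only [monomialEval, MonoidHom.coe_mk, OneHom.coe_mk, toAdd_ofAdd, Units.coe_prod,
    Units.val_zpow_eq_zpow_val]
  rw [valuation_prod]
  simp only [fun i => valuation_zpow_of_eq v (hc i)]
  rw [WithTop.coe_sum]
  exact Finset.sum_congr rfl fun i _ => by rw [mul_comm]

lemma laurentEval_eq_sum (c : Fin N → 𝕂ˣ) (g : LaurentPoly 𝕂 N) :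
    laurentEval c g =
      ∑ α ∈ g.coeff.support, g.coeff α * monomialEval c (Multiplicative.ofAdd α) := by
  rw [laurentEval, AddMonoidAlgebra.lift_apply]
  simp [Finsupp.sum]

/-- The valuation vector of a zero of `g` lies in the tropical hypersurface of `g`. -/
lemma mem_tropHypersurface_of_laurentEval_eq_zero {c : Fin N → 𝕂ˣ} {w : Fin N → ℝ}
    (hc : ∀ i, v (c i : 𝕂) = w i) {g : LaurentPoly 𝕂 N} (hg : g ≠ 0)
    (h : laurentEval c g = 0) : w ∈ tropHypersurface v g := by
  classical
  have hne : g.coeff.support.Nonempty := by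
    rw [Finsupp.support_nonempty_iff]
    simpa using hg
  obtain ⟨α, hα, hmin⟩ := g.coeff.support.exists_min_image (tropTerm v g w) hne
  by_contra hcon
  have hlt : ∀ γ ∈ g.coeff.support.erase α, tropTerm v g w α <
      v (g.coeff γ * monomialEval c (Multiplicative.ofAdd γ)) := by
    intro γ hγ
    rw [valuation_term v hc]
    obtain ⟨hγα, hγ⟩ := Finset.mem_erase.1 hγ
    refine lt_of_le_of_ne (hmin γ hγ) fun heq => hcon ⟨α, hα, γ, hγ, hγα.symm, heq, hmin⟩
  obtain ⟨r, hr⟩ := exists_valuation_eq_coe v (Finsupp.mem_support_iff.1 hα)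
  have htop : tropTerm v g w α ≠ ⊤ := by
    rw [tropTerm, hr, ← WithTop.coe_add]
    exact WithTop.coe_ne_top
  -- If the minimum is attained only at `α`, the remaining terms sum to something of strictly larger
  -- valuation. But they sum to minus the term at `α`.
  have hsum := AddValuation.map_lt_sum v htop hlt
  rw [laurentEval_eq_sum, ← Finset.add_sum_erase _ _ hα] at h
  rw [← neg_eq_of_add_eq_zero_right h, AddValuation.map_neg, valuation_term v hc] at hsum
  exact lt_irrefl _ hsum

/-- The valuation vector of a point of `X` in the torus lies in the tropicalization of `X`. -/
lemma mem_tropVariety_of_mem {X : Set (Fin N → 𝕂)} {c : Fin N → 𝕂} (hX : c ∈ X)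
    {w : Fin N → ℝ} (hc : ∀ i, v (c i) = w i) : w ∈ tropVariety v X := by
  have hc0 : ∀ i, c i ≠ 0 := fun i => by
    rw [← AddValuation.ne_top_iff v, hc]
    exact WithTop.coe_ne_top
  intro g hg hg0
  refine mem_tropHypersurface_of_laurentEval_eq_zero v (c := fun i => Units.mk0 (c i) (hc0 i))
    (by simpa using hc) hg0 ?_
  rw [torusIdeal, Submodule.mem_iInf] at hg
  have := hg (fun i => Units.mk0 (c i) (hc0 i))
  rw [Submodule.mem_iInf] at this
  exact this (by simpa using hX)

end Tropical

/-! ### Points of the Severi variety -/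

section Severi

open Polynomial

variable {𝕂 : Type*} [Field 𝕂]

/-- The simple roots of a polynomial with two double roots may be specialized arbitrarily
within the Severi variety. -/
lemma coeff_twoNodePoly_mem_Sev [Infinite 𝕂] {n : ℕ} {ℓ a b : 𝕂} (hℓ : ℓ ≠ 0) (ha : a ≠ 0)
    (hb : b ≠ 0) (hab : a ≠ b) (r : Fin (n - 4) → 𝕂) :
    (fun i : Fin (n + 1) => (twoNodePoly (n := n) ℓ a b r).coeff i) ∈ Sev 𝕂 n := by
  classical
  rw [Sev, zariskiClosure, MvPolynomial.mem_zeroLocus_iff]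
  intro p hp
  rw [MvPolynomial.mem_vanishingIdeal_iff] at hp
  obtain ⟨u, hu⟩ : ∃ u : Fin (n - 4) → 𝕂, Function.Injective u ∧ ∀ i, u i ≠ 0 := by
    let e := (Set.finite_singleton (0 : 𝕂)).infinite_compl.natEmbedding
    exact ⟨fun i => e i, fun i j h => Fin.ext (e.injective (Subtype.ext h)), fun i => (e i).2⟩
  -- The roots move along a line through `r`. Its slopes are nonzero and pairwise different, so no
  -- difference of two moving roots, or of a moving root and a constant, vanishes identically.
  let R : Fin (n - 4) → 𝕂[X] := fun i => C (r i) + C (u i) * X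
  have hR0 : ∀ (i : Fin (n - 4)) (z : 𝕂), R i - C z ≠ 0 := by
    intro i z h
    have := congrArg (coeff · 1) h
    simp [R, coeff_C, hu.2] at this
  have hRR : ∀ i j : Fin (n - 4), i ≠ j → R i - R j ≠ 0 := by
    intro i j hij h
    have := congrArg (coeff · 1) h
    simp [R, coeff_C, sub_eq_zero, hu.1.eq_iff, hij] at this
  let F : 𝕂[X][X] := C (C ℓ) * (X - C (C a)) ^ 2 * (X - C (C b)) ^ 2 * ∏ i, (X - C (R i))
  have hF : ∀ s : 𝕂, F.map (evalRingHom s) =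
      twoNodePoly (n := n) ℓ a b (fun i => (R i).eval s) := by
    intro s
    simp [F, twoNodePoly, Polynomial.map_prod]
  let q : 𝕂[X] := MvPolynomial.aeval (fun i : Fin (n + 1) => F.coeff i) p
  have hq : ∀ s : 𝕂, q.eval s = MvPolynomial.aeval (fun i : Fin (n + 1) =>
      (twoNodePoly (n := n) ℓ a b (fun i => (R i).eval s)).coeff i) p := by
    intro s
    simp only [← hF, coeff_map, q]
    rw [← coe_aeval_eq_eval, ← AlgHom.comp_apply, MvPolynomial.comp_aeval]
    rfl
  let D : 𝕂[X] := (∏ i, (R i - C 0) * (R i - C a) * (R i - C b)) *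
    ∏ x ∈ Finset.univ.filter (fun x : Fin (n - 4) × Fin (n - 4) => x.1 ≠ x.2), (R x.1 - R x.2)
  have hD : D ≠ 0 := by
    refine mul_ne_zero (Finset.prod_ne_zero_iff.2 fun i _ =>
      mul_ne_zero (mul_ne_zero (hR0 i _) (hR0 i _)) (hR0 i _)) (Finset.prod_ne_zero_iff.2 ?_)
    intro x hx
    exact hRR _ _ (Finset.mem_filter.1 hx).2
  -- Where `D` does not vanish the moved roots are admissible, so `q` vanishes there. The field is
  -- infinite, hence `q = 0`, and the parameter `0` gives back `r`.
  have hqD : q * D = 0 := by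
    refine Polynomial.funext fun s => ?_
    rw [eval_mul, eval_zero, mul_eq_zero, or_iff_not_imp_right]
    intro hs
    simp only [D, eval_mul, eval_prod, mul_ne_zero_iff, Finset.prod_ne_zero_iff, eval_sub, eval_C,
      Finset.mem_univ, true_imp_iff, Finset.mem_filter, true_and, sub_ne_zero] at hs
    obtain ⟨hs1, hs2⟩ := hs
    rw [hq]
    refine hp _ ⟨ℓ, a, b, fun i => (R i).eval s, hℓ, ha, hb, fun i => (hs1 i).1.1, hab,
      fun i => (hs1 i).1.2, fun i => (hs1 i).2, fun i j hij => ?_, fun i => rfl⟩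
    by_contra hne
    exact hs2 (i, j) hne hij
  have hq0 : q = 0 := (mul_eq_zero.1 hqD).resolve_right hD
  have := hq 0
  rw [hq0, eval_zero] at this
  simpa [R] using this.symm

lemma exists_univ_val_map_eq {α : Type*} {s : Multiset α} {m : ℕ} (h : s.card = m) :
    ∃ r : Fin m → α, Finset.univ.val.map r = s := by
  obtain ⟨l, rfl⟩ : ∃ l : List α, (l : Multiset α) = s := Quot.exists_rep s
  rw [Multiset.coe_card] at h
  subst h
  exact ⟨l.get, by rw [Fin.univ_val_map, List.ofFn_get]⟩

/-- A coefficient vector lies in the Severi variety as soon as the polynomial has two different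
nonzero double roots. -/
lemma mem_Sev_of_double_roots [IsAlgClosed 𝕂] {n : ℕ} (hn : 4 ≤ n) {c : Fin (n + 1) → 𝕂}
    (hc : c (Fin.last n) ≠ 0) {a b : 𝕂} (ha : a ≠ 0) (hb : b ≠ 0) (hab : a ≠ b)
    (ha1 : ∑ j, c j * a ^ (j : ℕ) = 0) (ha2 : ∑ j, c j * ((j : ℕ) * a ^ (j : ℕ)) = 0)
    (hb1 : ∑ j, c j * b ^ (j : ℕ) = 0) (hb2 : ∑ j, c j * ((j : ℕ) * b ^ (j : ℕ)) = 0) :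
    c ∈ Sev 𝕂 n := by
  classical
  have : Infinite 𝕂 := IsAlgClosed.instInfinite
  let f : 𝕂[X] := ∑ j : Fin (n + 1), C (c j) * X ^ (j : ℕ)
  have hcoeff : ∀ j : Fin (n + 1), f.coeff j = c j := by
    intro j
    simp only [f, finsetSum_coeff, coeff_C_mul, coeff_X_pow]
    simp [Fin.val_inj]
  have hf0 : f ≠ 0 := by
    intro h
    apply hc
    rw [← hcoeff, h, coeff_zero]
  have hdeg : f.natDegree = n := by
    refine le_antisymm (natDegree_sum_le_of_forall_le _ _ fun j _ =>
      (natDegree_C_mul_X_pow_le _ _).trans (Nat.lt_succ_iff.1 j.2)) (le_natDegree_of_ne_zero ?_)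
    simpa using (hcoeff (Fin.last n)).trans_ne hc
  have hdouble : ∀ z : 𝕂, z ≠ 0 → ∑ j, c j * z ^ (j : ℕ) = 0 →
      ∑ j, c j * ((j : ℕ) * z ^ (j : ℕ)) = 0 → (X - C z) ^ 2 ∣ f := by
    intro z hz h1 h2
    rw [← le_rootMultiplicity_iff hf0]
    refine (one_lt_rootMultiplicity_iff_isRoot hf0).2 ⟨?_, ?_⟩
    · simpa [f, IsRoot, eval_finsetSum] using h1
    -- The factor `z` avoids the exponent `j - 1`; it is cancelled at the end because `z ≠ 0`.
    · have : z * f.derivative.eval z = ∑ j, c j * ((j : ℕ) * z ^ (j : ℕ)) := by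
        simp only [f, derivative_sum, eval_finsetSum, Finset.mul_sum]
        refine Finset.sum_congr rfl fun j _ => ?_
        rcases Nat.eq_zero_or_pos (j : ℕ) with h | h
        · simp [h]
        · rw [derivative_C_mul_X_pow]
          obtain ⟨k, hk⟩ := Nat.exists_eq_succ_of_ne_zero h.ne'
          simp [hk, pow_succ]
          ring
      rw [h2] at this
      exact (mul_eq_zero.1 this).resolve_left hz
  obtain ⟨q, hq⟩ : (X - C a) ^ 2 * (X - C b) ^ 2 ∣ f :=
    ((isCoprime_X_sub_C_of_isUnit_sub (sub_ne_zero.2 hab).isUnit).pow).mul_dvd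
      (hdouble a ha ha1 ha2) (hdouble b hb hb1 hb2)
  have hq0 : q ≠ 0 := by
    rintro rfl
    exact hf0 (by rw [hq, mul_zero])
  have hmonic : ((X - C a) ^ 2 * (X - C b) ^ 2).Monic :=
    ((monic_X_sub_C a).pow 2).mul ((monic_X_sub_C b).pow 2)
  have hqdeg : q.natDegree = n - 4 := by
    have h := hmonic.natDegree_mul' hq0
    rw [← hq, hdeg, ((monic_X_sub_C a).pow 2).natDegree_mul ((monic_X_sub_C b).pow 2)] at h
    simp only [natDegree_pow, natDegree_X_sub_C] at h
    omega
  obtain ⟨r, hr⟩ := exists_univ_val_map_eq (s := q.roots) (m := n - 4)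
    (by rw [← hqdeg, (IsAlgClosed.splits q).natDegree_eq_card_roots])
  have hfeq : f = twoNodePoly (n := n) q.leadingCoeff a b r := by
    have hprod : ∏ i, (X - C (r i)) = (q.roots.map fun r => X - C r).prod := by
      rw [← hr, Multiset.map_map]
      rfl
    rw [twoNodePoly, hprod, hq]
    conv_lhs => rw [(IsAlgClosed.splits q).eq_prod_roots]
    ring
  have := coeff_twoNodePoly_mem_Sev (n := n) (leadingCoeff_ne_zero.2 hq0) ha hb hab r
  rw [← hfeq] at this
  simpa only [hcoeff] using this

end Severi

end TropSev

namespace TropSev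

/-! ### Lifting roots to the valuation ring -/

section Lifting

open Polynomial IsLocalRing

variable {L : Type*} [Field L] (V : ValuationSubring L)

/-- Each factor is `X - r = -r (1 - r⁻¹ X)`, and the second factor has coefficients in `V` and
constant term `1`. -/
lemma exists_map_eq_prod_X_sub_C (s : Multiset L) (hs : ∀ r ∈ s, r ≠ 0 ∧ r⁻¹ ∈ V) :
    ∃ (e : L) (H : V[X]), H.coeff 0 = 1 ∧
      C e * H.map V.subtype = (s.map fun r => X - C r).prod := by
  induction s using Multiset.induction_on with
  | empty => exact ⟨1, 1, by simp, by simp⟩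
  | cons r s ih =>
    obtain ⟨e, H, h0, hH⟩ := ih fun x hx => hs x (Multiset.mem_cons_of_mem hx)
    obtain ⟨hr0, hr⟩ := hs r (Multiset.mem_cons_self r s)
    refine ⟨-r * e, (1 - C ⟨r⁻¹, hr⟩ * X) * H, by simp [mul_coeff_zero, h0], ?_⟩
    rw [Multiset.map_cons, Multiset.prod_cons, ← hH]
    have : (C r : L[X]) * C r⁻¹ = 1 := by rw [← C_mul, mul_inv_cancel₀ hr0, C_1]
    simp only [Polynomial.map_mul, Polynomial.map_sub, Polynomial.map_one, map_C, map_X, C_mul,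
      C_neg, ValuationSubring.subtype_apply]
    linear_combination (X * C e * H.map V.subtype) * this

/-- Over an algebraically closed field, every root of the reduction of a polynomial over a
valuation ring lifts to a root in the valuation ring, if the reduction is nonzero. -/
lemma exists_root_of_residue_root [IsAlgClosed L] {P : V[X]} (hP : P.map (residue V) ≠ 0)
    {β : ResidueField V} (hβ : (P.map (residue V)).eval β = 0) :
    ∃ b : V, P.eval b = 0 ∧ residue V b = β := by
  obtain ⟨b₀, rfl⟩ := residue_surjective β
  -- Centre the polynomial at a lift `b₀` of `β`. If no root of `P` reduces to `β`, no root of `Q`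
  -- lies in the maximal ideal, so all their inverses lie in `V`. Then `Q` is its constant term
  -- `P.eval b₀` times a polynomial over `V`; that constant reduces to zero, hence so does `Q`, a
  -- contradiction.
  by_contra! hcon
  rw [eval_map, eval₂_at_apply] at hβ
  set Q := taylor b₀ P with hQ
  have hQ0 : Q.coeff 0 = P.eval b₀ := taylor_coeff_zero _ _
  have hQL : Q.map V.subtype ≠ 0 := by
    rw [Ne, Polynomial.map_eq_zero_iff V.subtype_injective, hQ, taylor_eq_zero]
    rintro rfl
    simp at hP
  have hroots : ∀ r ∈ (Q.map V.subtype).roots, r ≠ 0 ∧ r⁻¹ ∈ V := by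
    intro r hr
    have hr' : (Q.map V.subtype).eval r = 0 := (mem_roots hQL).1 hr
    have hnot : ∀ x : V, residue V x = 0 → (x : L) ≠ r := by
      rintro x hx rfl
      have h1 : Q.eval x = 0 := by
        rw [eval_map] at hr'
        have := eval₂_at_apply (p := Q) V.subtype x
        rw [ValuationSubring.subtype_apply, hr'] at this
        exact (map_eq_zero_iff _ V.subtype_injective).1 this.symm
      rw [hQ, taylor_eval] at h1
      exact hcon _ h1 (by rw [map_add, hx, zero_add])
    refine ⟨fun h => hnot 0 (map_zero _) (by simp [h]), ?_⟩
    by_contra hinv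
    have hrV : r ∈ V := (V.mem_or_inv_mem r).resolve_right hinv
    refine hnot ⟨r, hrV⟩ ?_ rfl
    rw [residue_eq_zero_iff, mem_maximalIdeal, mem_nonunits_iff]
    intro hu
    obtain ⟨y, hy⟩ := hu.exists_right_inv
    apply hinv
    have : r * (y : L) = 1 := congrArg Subtype.val hy
    rw [inv_eq_of_mul_eq_one_right this]
    exact y.2
  obtain ⟨e, H, hH0, hH⟩ := exists_map_eq_prod_X_sub_C V _ hroots
  have hfac := (IsAlgClosed.splits (Q.map V.subtype)).eq_prod_roots
  rw [← hH, ← mul_assoc, ← C_mul] at hfac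
  have hq : (Q.map V.subtype).leadingCoeff * e = V.subtype (P.eval b₀) := by
    have := congrArg (coeff · 0) hfac
    simp only [coeff_map, coeff_C_mul, hH0, hQ0, map_one, mul_one] at this
    exact this.symm
  have hQH : Q = C (P.eval b₀) * H := by
    apply Polynomial.map_injective _ V.subtype_injective
    rw [hfac, hq, Polynomial.map_mul, map_C]
  have hzero : Q.map (residue V) = 0 := by
    rw [hQH, Polynomial.map_mul, map_C, hβ, C_0, zero_mul]
  rw [hQ, map_taylor, taylor_eq_zero] at hzero
  exact hP hzero

end Lifting

/-! ### The kernel of the matrix at a pair of double roots -/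

section Kernel

variable {K : Type*} [Field K]

/-- If `1` and `β` are double roots of a trinomial, then either it vanishes, or the three powers
of `β` agree. -/
lemma trinomial_double_roots {p q r x y z e f g : K} (hpq : p ≠ q) (hpr : p ≠ r) (hqr : q ≠ r)
    (h1 : e + f + g = 0) (h2 : p * e + q * f + r * g = 0)
    (h3 : x * e + y * f + z * g = 0) (h4 : p * x * e + q * y * f + r * z * g = 0) :
    (e = 0 ∧ f = 0 ∧ g = 0) ∨ (x = y ∧ x = z) := by
  -- `a1` eliminates `g` and `a2` eliminates `f`; `b1` and `b2` do the same for the terms weighted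
  -- by `x`, `y`, `z`. Comparing the two isolates `e * (x - y)` and `e * (x - z)`.
  have a1 : (p - r) * e + (q - r) * f = 0 := by linear_combination h2 - r * h1
  have a2 : (p - q) * e - (q - r) * g = 0 := by linear_combination h2 - q * h1
  have b1 : (p - r) * (x * e) + (q - r) * (y * f) = 0 := by linear_combination h4 - r * h3
  have b2 : (p - q) * (x * e) - (q - r) * (z * g) = 0 := by linear_combination h4 - q * h3
  by_cases he : e = 0
  · left
    subst he
    refine ⟨rfl, ?_, ?_⟩
    · simpa [sub_eq_zero, hqr] using a1
    · simpa [sub_eq_zero, hqr] using a2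
  · right
    have c1 : ((p - r) * e) * (x - y) = 0 := by linear_combination b1 - y * a1
    have c2 : ((p - q) * e) * (x - z) = 0 := by linear_combination b2 - z * a2
    exact ⟨sub_eq_zero.1 ((mul_eq_zero.1 c1).resolve_left (mul_ne_zero (sub_ne_zero.2 hpr) he)),
      sub_eq_zero.1 ((mul_eq_zero.1 c2).resolve_left (mul_ne_zero (sub_ne_zero.2 hpq) he))⟩

/-- The matrix with columns `(1, p, β^p, p β^p)` for the exponents `p`. -/
def nodeMatrix {R ι : Type*} [CommRing R] (β : R) (k : ι → ℕ) : Matrix (Fin 4) ι R :=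
  Matrix.of fun l j => ![1, (k j : R), β ^ k j, (k j : R) * β ^ k j] l

lemma nodeMatrix_map {R S ι : Type*} [CommRing R] [CommRing S] (φ : R →+* S) (β : R)
    (k : ι → ℕ) : (nodeMatrix β k).map φ = nodeMatrix (φ β) k := by
  ext l j
  fin_cases l <;> simp [nodeMatrix]

/-- A zero coordinate leaves a trinomial with double roots `1` and `β`. Since at most two of the
powers of `β` agree, it must vanish identically. -/
lemma ne_zero_of_nodeMatrix_mulVec_eq_zero [CharZero K] {β : K} {k : Fin 4 → ℕ}
    (hk : Function.Injective k) (hrep : ∀ z : K, {j : Fin 4 | β ^ k j = z}.ncard ≤ 2)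
    {e : Fin 4 → K} (he : e ≠ 0) (h : (nodeMatrix β k).mulVec e = 0) (l : Fin 4) : e l ≠ 0 := by
  intro hl
  have hcast : ∀ i j : Fin 4, i ≠ j → (k i : K) ≠ k j := fun i j hij h =>
    hij (hk (Nat.cast_injective h))
  have h1 := congrFun h 0
  have h2 := congrFun h 1
  have h3 := congrFun h 2
  have h4 := congrFun h 3
  simp only [nodeMatrix, Matrix.mulVec, dotProduct, Fin.sum_univ_four, Matrix.of_apply,
    Matrix.cons_val, Pi.zero_apply, one_mul] at h1 h2 h3 h4
  have key : ∀ a b c : Fin 4, a ≠ b → a ≠ c → b ≠ c →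
      e a + e b + e c = 0 → k a * e a + k b * e b + k c * e c = 0 →
      β ^ k a * e a + β ^ k b * e b + β ^ k c * e c = 0 →
      k a * β ^ k a * e a + k b * β ^ k b * e b + k c * β ^ k c * e c = 0 →
      e a = 0 ∧ e b = 0 ∧ e c = 0 := by
    intro a b c hab hac hbc g1 g2 g3 g4
    refine (trinomial_double_roots (hcast _ _ hab) (hcast _ _ hac) (hcast _ _ hbc)
      g1 g2 g3 g4).resolve_right ?_
    rintro ⟨hxy, hxz⟩
    have hsub : (({a, b, c} : Finset (Fin 4)) : Set (Fin 4)) ⊆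
        {j : Fin 4 | β ^ k j = β ^ k a} := by
      intro j hj
      simp only [Finset.coe_insert, Finset.coe_singleton, Set.mem_insert_iff,
        Set.mem_singleton_iff] at hj
      rcases hj with rfl | rfl | rfl
      · rfl
      · exact hxy.symm
      · exact hxz.symm
    have := (Set.ncard_le_ncard hsub (Set.toFinite _)).trans (hrep _)
    rw [Set.ncard_coe_finset, Finset.card_eq_three.2 ⟨a, b, c, hab, hac, hbc, rfl⟩] at this
    omega
  apply he
  funext j
  fin_cases l <;> simp only [Fin.zero_eta, Fin.mk_one, Fin.reduceFinMk] at hl <;>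
    simp only [hl, mul_zero, zero_add, add_zero] at h1 h2 h3 h4
  · obtain ⟨u1, u2, u3⟩ := key 1 2 3 (by decide) (by decide) (by decide) h1 h2 h3 h4
    fin_cases j <;> assumption
  · obtain ⟨u1, u2, u3⟩ := key 0 2 3 (by decide) (by decide) (by decide) h1 h2 h3 h4
    fin_cases j <;> assumption
  · obtain ⟨u1, u2, u3⟩ := key 0 1 3 (by decide) (by decide) (by decide) h1 h2 h3 h4
    fin_cases j <;> assumption
  · obtain ⟨u1, u2, u3⟩ := key 0 1 2 (by decide) (by decide) (by decide) h1 h2 h3 h4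
    fin_cases j <;> assumption

/-- If every nonzero vector in the kernel of a square matrix has a nonzero coordinate at a given
place, the corresponding row of the adjugate is nonzero. -/
lemma adjugate_row_ne_zero {m : ℕ} (M : Matrix (Fin (m + 1)) (Fin (m + 1)) K)
    (h : ∀ e : Fin (m + 1) → K, e ≠ 0 → M.mulVec e = 0 → e (Fin.last m) ≠ 0) :
    M.adjugate (Fin.last m) ≠ 0 := by
  intro h0
  -- A relation among the columns other than the last, extended by `0`, is a kernel vector with last
  -- coordinate zero.
  have hli : LinearIndependent K fun j : Fin m => M.col j.castSucc := by
    rw [Fintype.linearIndependent_iff]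
    intro g hg
    by_contra! hne
    obtain ⟨j, hj⟩ := hne
    refine h (Fin.snoc g 0) (fun h' => hj ?_) ?_ (by simp)
    · simpa using congrFun h' j.castSucc
    · rw [Matrix.mulVec_eq_sum, Fin.sum_univ_castSucc]
      simpa using! hg
  -- Replacing the last column by a vector outside the span of the others gives an invertible
  -- matrix. By Cramer its determinant is the last row of the adjugate times `y`, so that row is not
  -- zero.
  obtain ⟨y, hy⟩ : ∃ y, y ∉ Submodule.span K (Set.range fun j : Fin m => M.col j.castSucc) := by
    by_contra! hall
    have htop := Submodule.eq_top_iff'.2 hall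
    have := finrank_range_le_card (R := K) (fun j : Fin m => M.col j.castSucc)
    rw [Set.finrank, htop, finrank_top, Module.finrank_fin_fun, Fintype.card_fin] at this
    omega
  have hli' := linearIndependent_finSnoc.2 ⟨hli, hy⟩
  have hcol : (Fin.snoc (fun j : Fin m => M.col j.castSucc) y : Fin (m + 1) → Fin (m + 1) → K) =
      (M.updateCol (Fin.last m) y).col := by
    funext j
    refine Fin.lastCases ?_ (fun j => ?_) j
    · ext l; simp [Matrix.col]
    · ext l
      simp [Matrix.col]
  rw [hcol, Matrix.linearIndependent_cols_iff_isUnit, Matrix.isUnit_iff_isUnit_det,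
    ← Matrix.cramer_apply, Matrix.cramer_eq_adjugate_mulVec] at hli'
  apply hli'.ne_zero
  rw [Matrix.mulVec, h0, zero_dotProduct]

end Kernel

/-! ### The minor -/

section Minor

open Polynomial

lemma minorD_eq {n : ℕ} (i : Fin 4 → Fin (n + 1)) :
    minorD i = (nodeMatrix (X : ℤ[X]) fun l => (i l : ℕ)).det := by
  rfl

/-- The exponent `k 2 + k 3` exceeds all the others in the expansion, and its coefficient `(k 1 - k
0) * (k 3 - k 2)` is nonzero in characteristic zero. -/
lemma det_nodeMatrix_ne_zero {K : Type*} [Field K] [CharZero K] {k : Fin 4 → ℕ}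
    (hk : StrictMono k) : (nodeMatrix (X : K[X]) k).det ≠ 0 := by
  have h01 : k 0 < k 1 := hk (by decide)
  have h12 : k 1 < k 2 := hk (by decide)
  have h23 : k 2 < k 3 := hk (by decide)
  have hdet : (nodeMatrix (X : K[X]) k).det =
      C (((k 1 : K) - k 0) * (k 3 - k 2)) * X ^ (k 2 + k 3)
      - C (((k 2 : K) - k 0) * (k 3 - k 1)) * X ^ (k 1 + k 3)
      + C (((k 3 : K) - k 0) * (k 2 - k 1)) * X ^ (k 1 + k 2)
      + C (((k 2 : K) - k 1) * (k 3 - k 0)) * X ^ (k 0 + k 3)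
      - C (((k 3 : K) - k 1) * (k 2 - k 0)) * X ^ (k 0 + k 2)
      + C (((k 3 : K) - k 2) * (k 1 - k 0)) * X ^ (k 0 + k 1) := by
    simp only [C_mul, C_sub, map_natCast, pow_add]
    simp [nodeMatrix, Matrix.det_succ_row_zero, Fin.sum_univ_succ, Fin.succAbove]
    ring
  intro h
  have hc := congrArg (coeff · (k 2 + k 3)) h
  rw [hdet] at hc
  simp only [coeff_add, coeff_sub, coeff_C_mul_X_pow, coeff_zero] at hc
  rw [if_pos trivial, if_neg (by omega), if_neg (by omega), if_neg (by omega), if_neg (by omega),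
    if_neg (by omega)] at hc
  simp only [sub_zero, add_zero, mul_eq_zero, sub_eq_zero, Nat.cast_inj] at hc
  omega

end Minor

end TropSev

namespace TropSev

/-! ### Lifting the coefficients -/

section LiftCoefficients

open Polynomial IsLocalRing

/-- The columns of this matrix are the unit vectors at the places `i l`, with `d` added to the
last one. -/
def selectionMatrix {R : Type*} [CommRing R] {n : ℕ} (i : Fin 4 → Fin (n + 1))
    (d : Fin (n + 1) → R) : Matrix (Fin (n + 1)) (Fin 4) R :=
  Matrix.of fun j l => (if j = i l then 1 else 0) + if l = 3 then d j else 0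

lemma selectionMatrix_map {R S : Type*} [CommRing R] [CommRing S] (φ : R →+* S) {n : ℕ}
    (i : Fin 4 → Fin (n + 1)) (d : Fin (n + 1) → R) :
    (selectionMatrix i d).map φ = selectionMatrix i fun j => φ (d j) := by
  ext j l
  simp only [selectionMatrix, Matrix.map_apply, Matrix.of_apply, map_add]
  split_ifs <;> simp

/-- Since the entries `d j` reduce to zero, this identifies the reduction of the lifted system with
the minor on `J`. -/
lemma nodeMatrix_mul_selectionMatrix_zero {R : Type*} [CommRing R] {n : ℕ} (z : R)
    (i : Fin 4 → Fin (n + 1)) :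
    nodeMatrix z (fun j : Fin (n + 1) => (j : ℕ)) * selectionMatrix i (0 : Fin (n + 1) → R) =
      nodeMatrix z fun l => (i l : ℕ) := by
  ext l j
  rw [Matrix.mul_apply]
  simp [selectionMatrix, nodeMatrix]

lemma selectionMatrix_mulVec_apply {R : Type*} [CommRing R] {n : ℕ} (i : Fin 4 → Fin (n + 1))
    (d : Fin (n + 1) → R) (e : Fin 4 → R) (j : Fin (n + 1)) :
    (selectionMatrix i d).mulVec e j = (∑ l, if j = i l then e l else 0) + d j * e 3 := by
  simp [Matrix.mulVec, dotProduct, selectionMatrix, add_mul, Finset.sum_add_distrib]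

variable {L : Type*} [Field L] (V : ValuationSubring L)

/-- Coefficients `d j` with positive valuation can be completed, up to a common unit, to a
polynomial with double roots `1` and `b`, by adding units on the support `i`. -/
lemma exists_double_root_lift [IsAlgClosed L] [CharZero (ResidueField V)] {n : ℕ}
    {i : Fin 4 → Fin (n + 1)} (hi : StrictMono i) {β : ResidueField V}
    (hβ : (nodeMatrix β fun l => (i l : ℕ)).det = 0)
    (hrep : ∀ z : ResidueField V, {j : Fin 4 | β ^ (i j : ℕ) = z}.ncard ≤ 2)
    {d : Fin (n + 1) → V} (hd : ∀ j, residue V (d j) = 0) (hdi : ∀ l, d (i l) = 0) :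
    ∃ (b u : V) (c : Fin (n + 1) → V), residue V b = β ∧ IsUnit u ∧ (∀ l, IsUnit (c (i l))) ∧
      (∀ j, (∀ l, j ≠ i l) → c j = d j * u) ∧
      (nodeMatrix b fun j : Fin (n + 1) => (j : ℕ)).mulVec c = 0 := by
  have hk : StrictMono fun l => (i l : ℕ) := hi
  -- Tying `d` to the last unknown makes the system homogeneous and square; it has a nonzero
  -- solution exactly at the roots of `P`.
  set P : V[X] := (nodeMatrix (X : V[X]) (fun j : Fin (n + 1) => (j : ℕ)) *
    selectionMatrix i fun j => C (d j)).det with hP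
  have hPmap : P.map (residue V) =
      (nodeMatrix (X : (ResidueField V)[X]) fun l => (i l : ℕ)).det := by
    rw [hP, ← coe_mapRingHom, RingHom.map_det, RingHom.mapMatrix_apply, Matrix.map_mul,
      nodeMatrix_map, selectionMatrix_map, ← nodeMatrix_mul_selectionMatrix_zero]
    congr 3
    · simp
    · funext j
      simp [hd]
  obtain ⟨b, hb, hbβ⟩ := exists_root_of_residue_root V (P := P) (β := β)
    (by rw [hPmap]; exact det_nodeMatrix_ne_zero hk)
    (by rw [hPmap, ← coe_evalRingHom, RingHom.map_det, RingHom.mapMatrix_apply, nodeMatrix_map]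
        simpa using hβ)
  set M := nodeMatrix b (fun j : Fin (n + 1) => (j : ℕ)) * selectionMatrix i d with hM
  have hdet : M.det = 0 := by
    rw [← hb, hP, ← coe_evalRingHom, RingHom.map_det, RingHom.mapMatrix_apply, Matrix.map_mul,
      nodeMatrix_map, selectionMatrix_map]
    simp [hM]
  have hMres : M.map (residue V) = nodeMatrix β fun l => (i l : ℕ) := by
    rw [hM, Matrix.map_mul, nodeMatrix_map, selectionMatrix_map, hbβ,
      ← nodeMatrix_mul_selectionMatrix_zero]
    simp only [hd]
    rfl
  have hker : ∀ e : Fin 4 → ResidueField V, e ≠ 0 → (M.map (residue V)).mulVec e = 0 →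
      ∀ l, e l ≠ 0 := by
    intro e he h
    rw [hMres] at h
    exact ne_zero_of_nodeMatrix_mulVec_eq_zero hk.injective hrep he h
  obtain ⟨l, hl⟩ := Function.ne_iff.1 (adjugate_row_ne_zero (M.map (residue V))
    fun e he h => hker e he h _)
  have hadj : ∀ j, residue V (M.adjugate j l) = (M.map (residue V)).adjugate j l := by
    intro j
    rw [← RingHom.mapMatrix_apply, ← RingHom.map_adjugate]
    rfl
  -- A column of the adjugate of a singular matrix lies in its kernel, and `l` is chosen so that
  -- this one stays nonzero after reduction.
  let e : Fin 4 → V := fun j => M.adjugate j l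
  have he : M.mulVec e = 0 := by
    funext j
    have := congrFun (congrFun (Matrix.mul_adjugate M) j) l
    rw [hdet, zero_smul] at this
    exact this
  have heunit : ∀ j, IsUnit (e j) := by
    intro j
    rw [← residue_ne_zero_iff_isUnit]
    refine hker (fun j => residue V (e j)) (fun h => ?_) ?_ j
    · apply hl
      rw [← hadj]
      exact congrFun h _
    · funext j
      have := RingHom.map_mulVec (residue V) M e j
      rw [he] at this
      simpa using! this.symm
  refine ⟨b, e 3, (selectionMatrix i d).mulVec e, hbβ, heunit 3, fun l => ?_, fun j hj => ?_, ?_⟩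
  · rw [selectionMatrix_mulVec_apply, hdi, zero_mul, add_zero]
    simpa [hi.injective.eq_iff] using heunit l
  · rw [selectionMatrix_mulVec_apply, Finset.sum_eq_zero (fun l _ => if_neg (hj l)), zero_add]
  · rw [Matrix.mulVec_mulVec]
    exact he

end LiftCoefficients

/-! ### Points with values in the value group -/

section Points

open IsLocalRing

variable {𝕂 : Type*} [Field 𝕂] (v : AddValuation 𝕂 (WithTop ℝ))

lemma mem_valuationSubring_iff_nonneg {x : 𝕂} :
    x ∈ (AddValuation.toValuation v).valuationSubring ↔ 0 ≤ v x :=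
  Iff.rfl

lemma valuation_eq_zero_of_isUnit {x : (AddValuation.toValuation v).valuationSubring}
    (hx : IsUnit x) : v (x : 𝕂) = 0 := by
  obtain ⟨y, hy⟩ := hx.exists_right_inv
  have h := AddValuation.map_mul v (x : 𝕂) y
  have hxy : (x : 𝕂) * y = 1 := congrArg Subtype.val hy
  rw [hxy, AddValuation.map_one] at h
  have hx0 : 0 ≤ v (x : 𝕂) := x.2
  have hy0 : 0 ≤ v (y : 𝕂) := y.2
  refine le_antisymm ?_ hx0
  rw [h]
  exact le_add_of_nonneg_right hy0

lemma residue_eq_zero_of_pos {x : (AddValuation.toValuation v).valuationSubring}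
    (hx : 0 < v (x : 𝕂)) : residue _ x = 0 := by
  rw [residue_eq_zero_iff, mem_maximalIdeal, mem_nonunits_iff]
  intro hu
  rw [valuation_eq_zero_of_isUnit v hu] at hx
  exact lt_irrefl _ hx

variable [IsAlgClosed 𝕂]

/-- Roots of high order of one element of nonzero value have arbitrarily small nonzero values, and
the integer multiples of such a value come close to every real number. -/
lemma exists_valuation_near (hv : ∃ x : 𝕂, x ≠ 0 ∧ v x ≠ 0) (r : ℝ) {ε : ℝ} (hε : 0 < ε) :
    ∃ (x : 𝕂) (s : ℝ), v x = s ∧ |s - r| < ε := by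
  obtain ⟨x, hx, hvx⟩ := hv
  obtain ⟨ρ, hρ⟩ := exists_valuation_eq_coe v hx
  have hρ0 : ρ ≠ 0 := by
    rintro rfl
    exact hvx hρ
  obtain ⟨m, hm⟩ := exists_nat_gt (|ρ| / ε)
  have hm0 : (0 : ℝ) < m := (div_nonneg (abs_nonneg _) hε.le).trans_lt hm
  have hm0' : 0 < m := by exact_mod_cast hm0
  obtain ⟨y, hy⟩ := IsAlgClosed.exists_pow_nat_eq x hm0'
  have hy0 : y ≠ 0 := by
    rintro rfl
    exact hx (by rw [← hy, zero_pow hm0'.ne'])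
  obtain ⟨σ, hσ⟩ := exists_valuation_eq_coe v hy0
  have hσρ : m * σ = ρ := by
    have := valuation_pow_of_eq v hσ m
    rw [hy, hρ, WithTop.coe_eq_coe] at this
    exact this.symm
  have hσ0 : σ ≠ 0 := by
    rintro rfl
    exact hρ0 (by rw [← hσρ, mul_zero])
  have hσε : |σ| < ε := by
    rw [div_lt_iff₀ hε, ← hσρ, abs_mul, abs_of_pos hm0] at hm
    exact lt_of_mul_lt_mul_left hm hm0.le
  refine ⟨y ^ round (r / σ), round (r / σ) * σ, valuation_zpow_of_eq v hσ _, ?_⟩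
  have h1 : (round (r / σ) : ℝ) * σ - r = -((r / σ - round (r / σ)) * σ) := by
    field_simp
    ring
  rw [h1, abs_neg, abs_mul]
  have h2 := abs_sub_round (r / σ)
  have h3 := abs_pos.2 hσ0
  nlinarith

/-- The points of the tropical Severi variety with coordinates in the value group. -/
lemma mem_tropSev_of_value_group [CharZero (ResField v)] {n : ℕ} (hn : 4 ≤ n)
    {i : Fin 4 → Fin (n + 1)} (hi : StrictMono i) {β : ResField v} (hβ0 : β ≠ 0) (hβ1 : β ≠ 1)
    (hβ : (nodeMatrix β fun l => (i l : ℕ)).det = 0)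
    (hrep : ∀ z : ResField v, {j : Fin 4 | β ^ (i j : ℕ) = z}.ncard ≤ 2)
    {κ τ : ℝ} {s : Fin (n + 1) → ℝ} {k t : 𝕂} {x : Fin (n + 1) → 𝕂} (hk : v k = κ)
    (ht : v t = τ) (hx : ∀ j, v (x j) = s j) (hs : ∀ j, (∀ l, j ≠ i l) → 0 < s j)
    (hs0 : ∀ l, s (i l) = 0) :
    (fun j : Fin (n + 1) => κ + (j : ℕ) * τ + s j) ∈ tropSev v n := by
  classical
  -- On `J` the value is `0`, because the coefficients there are the unknowns of the linear system.
  have hd : ∀ j, ∃ d : (AddValuation.toValuation v).valuationSubring,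
      residue _ d = 0 ∧ (∀ l, j = i l → d = 0) ∧ ((∀ l, j ≠ i l) → (d : 𝕂) = x j) := by
    intro j
    by_cases h : ∀ l, j ≠ i l
    · have hpos : 0 < v (x j) := by
        rw [hx, ← WithTop.coe_zero, WithTop.coe_lt_coe]
        exact hs j h
      exact ⟨⟨x j, (mem_valuationSubring_iff_nonneg v).2 hpos.le⟩,
        residue_eq_zero_of_pos v hpos, fun l hl => absurd hl (h l), fun _ => rfl⟩
    · exact ⟨0, map_zero _, fun _ _ => rfl, fun h' => absurd h' h⟩
  choose d hdres hdi hdx using hd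
  obtain ⟨b, u, c, hb, hu, hci, hcj, hker⟩ := exists_double_root_lift _ hi hβ hrep hdres
    (fun l => hdi _ l rfl)
  have hvc : ∀ j, v (c j : 𝕂) = s j := by
    intro j
    by_cases h : ∀ l, j ≠ i l
    · rw [hcj j h]
      push_cast
      rw [AddValuation.map_mul, valuation_eq_zero_of_isUnit v hu, add_zero, hdx j h, hx]
    · push Not at h
      obtain ⟨l, rfl⟩ := h
      rw [valuation_eq_zero_of_isUnit v (hci l), hs0]
      rfl
  have ht0 : t ≠ 0 := by
    rw [← AddValuation.ne_top_iff v, ht]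
    exact WithTop.coe_ne_top
  have hb0 : (b : 𝕂) ≠ 0 := by
    intro h
    apply hβ0
    rw [← hb, show b = 0 from Subtype.ext h, map_zero]
  have hb1 : (b : 𝕂) ≠ 1 := by
    intro h
    apply hβ1
    rw [← hb, show b = 1 from Subtype.ext h, map_one]
  have hval : ∀ j : Fin (n + 1), v (k * t ^ (j : ℕ) * c j) =
      ((κ + (j : ℕ) * τ + s j : ℝ) : WithTop ℝ) := by
    intro j
    rw [AddValuation.map_mul, AddValuation.map_mul, hk, valuation_pow_of_eq v ht, hvc,
      ← WithTop.coe_add, ← WithTop.coe_add]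
  refine mem_tropVariety_of_mem v (c := fun j : Fin (n + 1) => k * t ^ (j : ℕ) * c j) ?_ hval
  have hrows : ∀ l, ∑ j, nodeMatrix (b : 𝕂) (fun j : Fin (n + 1) => (j : ℕ)) l j * c j = 0 := by
    intro l
    have := RingHom.map_mulVec (AddValuation.toValuation v).valuationSubring.subtype
      (nodeMatrix b fun j : Fin (n + 1) => (j : ℕ)) c l
    rw [hker, nodeMatrix_map] at this
    simpa using! this.symm
  -- Multiplying the `j`-th coefficient by `k * t ^ j` adds `κ + j * τ` to its valuation and moves
  -- the double roots `1`, `b` to `t⁻¹`, `b * t⁻¹`.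
  have hscale : ∀ (y z : 𝕂) (j : ℕ), k * t ^ j * z * (y * t⁻¹) ^ j = k * (y ^ j * z) := by
    intro y z j
    rw [mul_pow, inv_pow]
    field_simp
  have hsum : ∀ y : 𝕂, ∑ j : Fin (n + 1), y ^ (j : ℕ) * (c j : 𝕂) = 0 →
      ∑ j : Fin (n + 1), k * t ^ (j : ℕ) * c j * (y * t⁻¹) ^ (j : ℕ) = 0 := by
    intro y h
    simp only [hscale]
    rw [← Finset.mul_sum, h, mul_zero]
  have hsum' : ∀ y : 𝕂, ∑ j : Fin (n + 1), (j : ℕ) * y ^ (j : ℕ) * (c j : 𝕂) = 0 →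
      ∑ j : Fin (n + 1), k * t ^ (j : ℕ) * c j * ((j : ℕ) * (y * t⁻¹) ^ (j : ℕ)) = 0 := by
    intro y h
    rw [← mul_zero k, ← h, Finset.mul_sum]
    refine Finset.sum_congr rfl fun j _ => ?_
    rw [mul_left_comm, hscale]
    ring
  refine mem_Sev_of_double_roots hn (a := 1 * t⁻¹) (b := b * t⁻¹) ?_ (by simpa using ht0)
    (mul_ne_zero hb0 (inv_ne_zero ht0)) ?_ (hsum _ ?_) (hsum' _ ?_) (hsum _ ?_) (hsum' _ ?_)
  · rw [← AddValuation.ne_top_iff v, hval]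
    exact WithTop.coe_ne_top
  · intro h
    exact hb1 (mul_right_cancel₀ (inv_ne_zero ht0) h).symm
  · simpa [nodeMatrix] using hrows 0
  · simpa [nodeMatrix] using hrows 1
  · simpa [nodeMatrix] using hrows 2
  · simpa [nodeMatrix] using hrows 3

/-- All weights with lower cell given by `i` lie in the tropical Severi variety. -/
lemma mem_tropSev_of_lowerCell (hv : ∃ x : 𝕂, x ≠ 0 ∧ v x ≠ 0) [CharZero (ResField v)]
    {n : ℕ} (hn : 4 ≤ n) {i : Fin 4 → Fin (n + 1)} (hi : StrictMono i) {β : ResField v}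
    (hβ0 : β ≠ 0) (hβ1 : β ≠ 1) (hβ : (nodeMatrix β fun l => (i l : ℕ)).det = 0)
    (hrep : ∀ z : ResField v, {j : Fin 4 | β ^ (i j : ℕ) = z}.ncard ≤ 2)
    {w : Fin (n + 1) → ℝ} {η : ℝ} (hw : Finset.univ.image i = lowerCell w η) :
    w ∈ tropSev v n := by
  have hcell : ∀ j, (∃ l, i l = j) ↔ ∀ k : Fin (n + 1),
      η * ((j : ℕ) : ℝ) + w j ≤ η * ((k : ℕ) : ℝ) + w k := by
    intro j
    have := congrArg (j ∈ ·) hw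
    simpa [lowerCell] using this
  set κ := η * ((i 0 : ℕ) : ℝ) + w (i 0) with hκ
  have hmin : ∀ j : Fin (n + 1), κ ≤ η * ((j : ℕ) : ℝ) + w j := (hcell (i 0)).1 ⟨0, rfl⟩
  have hon : ∀ l, η * ((i l : ℕ) : ℝ) + w (i l) = κ := fun l =>
    le_antisymm ((hcell (i l)).1 ⟨l, rfl⟩ _) (hmin _)
  have hoff : ∀ j, (∀ l, j ≠ i l) → κ < η * ((j : ℕ) : ℝ) + w j := by
    intro j hj
    refine lt_of_le_of_ne (hmin j) fun h => ?_
    obtain ⟨l, hl⟩ := (hcell j).2 fun m => h ▸ hmin m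
    exact hj l hl.symm
  refine (isClosed_tropIdeal v _).closure_subset (Metric.mem_closure_iff.2 fun ε hε => ?_)
  obtain ⟨δ, hδ, hδε⟩ : ∃ δ : ℝ, 0 < δ ∧ δ * (n + 2) < ε := by
    -- The total error will be at most `δ + n * δ + δ`; dividing by `n + 3` makes the bound strict.
    refine ⟨ε / (n + 3), by positivity, ?_⟩
    rw [div_mul_eq_mul_div, div_lt_iff₀ (by positivity)]
    nlinarith
  obtain ⟨k, κ', hk, hκ'⟩ := exists_valuation_near v hv κ hδ
  -- The sign comes from `w j = κ - η * j + s j`, where `s j` is the height above the supporting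
  -- line.
  obtain ⟨t, τ, ht, hτ⟩ := exists_valuation_near v hv (-η) hδ
  have hx : ∀ j : Fin (n + 1), ∃ (x : 𝕂) (s : ℝ), v x = s ∧
      |s - (η * ((j : ℕ) : ℝ) + w j - κ)| < δ ∧ ((∀ l, j ≠ i l) → 0 < s) ∧
      ((∃ l, j = i l) → s = 0) := by
    intro j
    by_cases h : ∀ l, j ≠ i l
    · obtain ⟨x, s, hxs, hs⟩ := exists_valuation_near v hv (η * ((j : ℕ) : ℝ) + w j - κ)
        -- An error smaller than the gap itself keeps the approximated height positive.
        (lt_min hδ (sub_pos.2 (hoff j h)))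
      rw [lt_min_iff] at hs
      refine ⟨x, s, hxs, hs.1, fun _ => ?_, fun ⟨l, hl⟩ => absurd hl (h l)⟩
      have := (abs_lt.1 hs.2).1
      linarith
    · push Not at h
      obtain ⟨l, rfl⟩ := h
      refine ⟨1, 0, AddValuation.map_one v, ?_, fun h => absurd rfl (h l), fun _ => rfl⟩
      rw [hon, sub_self, sub_self, abs_zero]
      exact hδ
  choose x s hxs hs hspos hs0 using hx
  refine ⟨_, mem_tropSev_of_value_group v hn hi hβ0 hβ1 hβ hrep hk ht hxs hspos
    (fun l => hs0 _ ⟨l, rfl⟩), (dist_pi_lt_iff hε).2 fun j => ?_⟩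
  rw [dist_comm, Real.dist_eq]
  have hj : ((j : ℕ) : ℝ) ≤ n := by exact_mod_cast Nat.lt_succ_iff.1 j.2
  have hj0 : (0 : ℝ) ≤ ((j : ℕ) : ℝ) := Nat.cast_nonneg _
  have hsplit : κ' + (j : ℕ) * τ + s j - w j =
      (κ' - κ) + (j : ℕ) * (τ - -η) + (s j - (η * ((j : ℕ) : ℝ) + w j - κ)) := by ring
  calc |κ' + (j : ℕ) * τ + s j - w j|
      ≤ |κ' - κ| + |((j : ℕ) : ℝ) * (τ - -η)| + |s j - (η * ((j : ℕ) : ℝ) + w j - κ)| := by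
        rw [hsplit]
        exact abs_add_three _ _ _
    _ ≤ δ + n * δ + δ := by
        rw [abs_mul, abs_of_nonneg hj0]
        have := hs j
        gcongr
    _ = δ * (n + 2) := by ring
    _ < ε := hδε

end Points

end TropSev

theorem mainTheorem4
    {𝕂 : Type*} [Field 𝕂] [IsAlgClosed 𝕂]
    (v : AddValuation 𝕂 (WithTop ℝ)) (hv : ∃ x : 𝕂, x ≠ 0 ∧ v x ≠ 0)
    [CharZero (TropSev.ResField v)]
    (n : ℕ) (hn : 4 ≤ n)
    (i : Fin 4 → Fin (n + 1)) (hi : StrictMono i)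
    (C : Set (Fin (n + 1) → ℝ)) (hC : TropSev.IsTypeIICone C (Finset.univ.image i))
    (β : TropSev.ResField v) (hβ0 : β ≠ 0) (hβ1 : β ≠ 1)
    (hroot : Polynomial.aeval β (TropSev.minorD i) = 0)
    (hrep : ∀ z : TropSev.ResField v, {j : Fin 4 | β ^ ((i j : Fin (n + 1)) : ℕ) = z}.ncard ≤ 2)
    (w : Fin (n + 1) → ℝ) (hw : w ∈ C) :
    w ∈ TropSev.tropSev v n := by
  have hβ : (TropSev.nodeMatrix β fun l => (i l : ℕ)).det = 0 := by
    have h : (Polynomial.aeval β).toRingHom (TropSev.minorD i) = 0 := hroot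
    rw [TropSev.minorD_eq, RingHom.map_det, RingHom.mapMatrix_apply, TropSev.nodeMatrix_map] at h
    simpa using h
  obtain ⟨Pi, hPi, rfl⟩ := hC
  -- The cone is a closure and the tropical variety is closed, so only weights inducing `Pi` matter;
  -- for these `J` is a lower cell.
  refine closure_minimal (fun w' hw' => ?_) (TropSev.isClosed_tropIdeal v _) hw
  have hJ := hPi.mem
  rw [← show TropSev.subdivision w' = Pi from hw'] at hJ
  obtain ⟨-, η, hη⟩ := hJ
  exact TropSev.mem_tropSev_of_lowerCell v hv hn hi hβ0 hβ1 hβ hrep hη
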